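/- Let $D\ge 0$ and let $\mathcal M$ be the set of Borel probability measures on $\mathbb R^D$ with finite second moment. For $\mu,\nu\in\mathcal M$ let $\Gamma(\mu,\nu)$ be the set of Borel measures on $\mathbb R^D\times\mathbb R^D$ with marginals $\mu$ and $\nu$, let $$W_2(\mu,\nu)=\Bigl(\inf_{\gamma\in\Gamma(\mu,\nu)}\int |x-y|^2\,d\gamma(x,y)\Bigr)^{1/2},$$ and let $\Gamma_o(\mu,\nu)$ be the set of $\gamma\in\Gamma(\mu,\nu)$ that attain this infimum. A function $F:\mathcal M\to(-\infty,\infty]$ is proper if it is not identically $\infty$. For $\lambda\in\mathbb R$, a proper $F$ is called $\lambda$-convex if for all $\mu_0,\mu_1\in\mathcal M$, all $\gamma\in\Gamma_o(\mu_0,\mu_1)$ and all $t\in[0,1]$, with $\mu_t=((1-t)\pi^1+t\pi^2)_\#\gamma$ (where $\pi^1(x,y)=x$, $\pi^2(x,y)=y$), $$F(\mu_t)\le(1-t)F(\mu_0)+tF(\mu_1)-\frac{\lambda}{2}\,t(1-t)\,W_2^2(\mu_0,\mu_1)\qquad(0\cdot\infty=0),$$ and $G:\mathcal M\to[-\infty,\infty)$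 is called $\lambda$-concave if $-G$ is (proper and) $(-\lambda)$-convex. Let $H:\mathcal M\to(-\infty,\infty]$ be proper, and for $\tau>0$ and $\mu\in\mathcal M$ let $$H_\tau(\mu)=\inf_{\nu\in\mathcal M}\Bigl\{\frac1{2\tau}W_2^2(\mu,\nu)+H(\nu)\Bigr\}\in[-\infty,\infty).$$ Suppose that $H$ is coercive, i.e. $H_{\tau_*}(\mu_*)>-\infty$ for some $\tau_*>0$ and $\mu_*\in\mathcal M$. Then, for every $\tau>0$, $H_\tau<\infty$ everywhere and for all $\mu_0,\mu_1\in\mathcal M$, $\gamma\in\Gamma_o(\mu_0,\mu_1)$ and $t\in[0,1]$, with $\mu_t$ as above, $$H_\tau(\mu_t)\ \ge\ (1-t)H_\tau(\mu_0)+tH_\tau(\mu_1)-\frac1{2\tau}\,t(1-t)\,W_2^2(\mu_0,\mu_1)$$ (in $[-\infty,\infty)$, with $0\cdot(-\infty)=0$). Consequently $H_\tau$ is $\frac1\tau$-concave for every $\tau>0$ for which $H_\tau$ is not identically $-\infty$; and there is $\tau_s>0$ such that $H_\tau$ is $\frac1\tau$-concave for every $\tau\in(0,\tau_s]$. -/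

import Mathlib

open MeasureTheory Set

open scoped ENNReal

noncomputable section

namespace Wass

/-- The Borel probability measures on Euclidean space `ℝ^D` with finite second moment. -/
def P2 (D : ℕ) : Type :=
  {μ : Measure (EuclideanSpace ℝ (Fin D)) //
    IsProbabilityMeasure μ ∧ ∫⁻ x, ‖x‖ₑ ^ 2 ∂μ < ∞}

/-- The transport plans from `μ` to `ν`: Borel measures on `ℝ^D × ℝ^D` with marginals `μ`, `ν`. -/
def plans {D : ℕ} (μ ν : P2 D) :
    Set (Measure (EuclideanSpace ℝ (Fin D) × EuclideanSpace ℝ (Fin D))) :=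
  {γ | γ.map Prod.fst = μ.1 ∧ γ.map Prod.snd = ν.1}

/-- The quadratic transport cost of a plan. -/
def cost {D : ℕ} (γ : Measure (EuclideanSpace ℝ (Fin D) × EuclideanSpace ℝ (Fin D))) : ℝ≥0∞ :=
  ∫⁻ p, ‖p.1 - p.2‖ₑ ^ 2 ∂γ

/-- The quadratic Wasserstein distance (the infimum is finite, see `iInf_cost_lt_top`). -/
def W2 {D : ℕ} (μ ν : P2 D) : ℝ :=
  Real.sqrt (⨅ γ ∈ plans μ ν, cost γ).toReal

/-- The optimal plans from `μ` to `ν`: those that minimize the transport cost. -/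
def optimalPlans {D : ℕ} (μ ν : P2 D) :
    Set (Measure (EuclideanSpace ℝ (Fin D) × EuclideanSpace ℝ (Fin D))) :=
  {γ | γ ∈ plans μ ν ∧ ∀ γ' ∈ plans μ ν, cost γ ≤ cost γ'}

theorem lintegral_sq_lt_top_iff {Ω E : Type*} [MeasurableSpace Ω] [NormedAddCommGroup E]
    {m : Measure Ω} {f : Ω → E} (hf : AEStronglyMeasurable f m) :
    ∫⁻ x, ‖f x‖ₑ ^ 2 ∂m < ∞ ↔ MemLp f 2 m := by
  have h := eLpNorm_lt_top_iff_lintegral_rpow_enorm_lt_top (f := f) (μ := m)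
    (p := 2) (by norm_num) (by norm_num)
  simp only [ENNReal.toReal_ofNat, ENNReal.rpow_ofNat] at h
  rw [← h]
  exact ⟨fun h1 => ⟨hf, h1⟩, fun h1 => h1.2⟩

theorem memLp_fst {D : ℕ} {μ ν : P2 D}
    {γ : Measure (EuclideanSpace ℝ (Fin D) × EuclideanSpace ℝ (Fin D))} (h : γ ∈ plans μ ν) :
    MemLp Prod.fst 2 γ := by
  rw [← lintegral_sq_lt_top_iff (by fun_prop)]
  have h2 := μ.2.2
  rw [← h.1, lintegral_map (by fun_prop) (by fun_prop)] at h2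
  exact h2

theorem memLp_snd {D : ℕ} {μ ν : P2 D}
    {γ : Measure (EuclideanSpace ℝ (Fin D) × EuclideanSpace ℝ (Fin D))} (h : γ ∈ plans μ ν) :
    MemLp Prod.snd 2 γ := by
  rw [← lintegral_sq_lt_top_iff (by fun_prop)]
  have h2 := ν.2.2
  rw [← h.2, lintegral_map (by fun_prop) (by fun_prop)] at h2
  exact h2

theorem cost_lt_top {D : ℕ} {μ ν : P2 D}
    {γ : Measure (EuclideanSpace ℝ (Fin D) × EuclideanSpace ℝ (Fin D))} (h : γ ∈ plans μ ν) :
    cost γ < ∞ :=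
  (lintegral_sq_lt_top_iff (by fun_prop)).2 ((memLp_fst h).sub (memLp_snd h))

theorem prod_mem_plans {D : ℕ} (μ ν : P2 D) : μ.1.prod ν.1 ∈ plans μ ν := by
  have := μ.2.1
  have := ν.2.1
  constructor <;> simp

theorem iInf_cost_lt_top {D : ℕ} (μ ν : P2 D) : ⨅ γ ∈ plans μ ν, cost γ < ∞ :=
  (iInf₂_le _ (prod_mem_plans μ ν)).trans_lt (cost_lt_top (prod_mem_plans μ ν))

/-- The interpolation `μ_t = ((1 - t) π¹ + t π²)_# γ` along a plan `γ`. -/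
def interp {D : ℕ} {μ ν : P2 D}
    (γ : Measure (EuclideanSpace ℝ (Fin D) × EuclideanSpace ℝ (Fin D)))
    (h : γ ∈ plans μ ν) (t : ℝ) : P2 D :=
  ⟨γ.map (fun p => (1 - t) • p.1 + t • p.2), by
    constructor
    · have hm := μ.2.1
      rw [← h.1] at hm
      have : IsProbabilityMeasure γ := Measure.isProbabilityMeasure_of_map Prod.fst
      exact Measure.isProbabilityMeasure_map (by fun_prop)
    · rw [lintegral_map (by fun_prop) (by fun_prop)]
      exact (lintegral_sq_lt_top_iff (by fun_prop)).2
        (((memLp_fst h).const_smul (1 - t)).add ((memLp_snd h).const_smul t))⟩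

/-- `F` takes values in `(-∞, ∞]` and is not identically `∞`. -/
def IsProper {D : ℕ} (F : P2 D → EReal) : Prop :=
  (∀ μ, F μ ≠ ⊥) ∧ ∃ μ, F μ ≠ ⊤

/-- The `lam`-convexity inequality along every geodesic induced by an optimal plan.
It is meant for `F` with values in `(-∞, ∞]`, so that no sum is indeterminate. -/
def ConvexAlongGeodesics {D : ℕ} (F : P2 D → EReal) (lam : ℝ) : Prop :=
  ∀ (μ₀ μ₁ : P2 D) (γ : Measure (EuclideanSpace ℝ (Fin D) × EuclideanSpace ℝ (Fin D)))
    (hγ : γ ∈ optimalPlans μ₀ μ₁), ∀ t ∈ Icc (0 : ℝ) 1,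
      F (interp γ hγ.1 t) ≤
        ((1 - t : ℝ) : EReal) * F μ₀ + (t : EReal) * F μ₁
          - ((lam / 2 * t * (1 - t) * W2 μ₀ μ₁ ^ 2 : ℝ) : EReal)

/-- `F` is `lam`-convex: it is proper and satisfies the `lam`-convexity inequality. -/
def IsLambdaConvex {D : ℕ} (F : P2 D → EReal) (lam : ℝ) : Prop :=
  IsProper F ∧ ConvexAlongGeodesics F lam

/-- `F` is `lam`-concave if `-F` is `(-lam)`-convex. -/
def IsLambdaConcave {D : ℕ} (F : P2 D → EReal) (lam : ℝ) : Prop :=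
  IsLambdaConvex (fun μ => -F μ) (-lam)

/-- The Moreau–Yosida approximation `H_τ` of `H`. -/
def moreauYosida {D : ℕ} (H : P2 D → EReal) (τ : ℝ) (μ : P2 D) : EReal :=
  ⨅ ν : P2 D, ((1 / (2 * τ) * W2 μ ν ^ 2 : ℝ) : EReal) + H ν

/-- `H` is coercive: `H_τ(μ) > -∞` for at least one `τ > 0` and one `μ`. -/
def IsCoercive {D : ℕ} (H : P2 D → EReal) : Prop :=
  ∃ τ : ℝ, 0 < τ ∧ ∃ μ : P2 D, ⊥ < moreauYosida H τ μ

end Wass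

end

open scoped ProbabilityTheory

namespace Wass

/-! For fixed `ν`, the function `W2 · ν ^ 2` is 2-concave along geodesics (`W2_sq_interp`). This
comes from the Euclidean identity `convexComb_sub_sq_add`, integrated against a three-marginal
measure obtained by gluing `γ` to a plan from `μ_t` to `ν` (`exists_gluing`). Dividing by `2τ` and
adding the constant `H ν` gives `1/τ`-concave functions of `μ`, and `H_τ` is their infimum over `ν`.
Coercivity only serves to exclude `H_τ ≡ -∞`. -/

theorem isProbabilityMeasure_of_mem_plans {D : ℕ} {μ ν : P2 D}
    {γ : Measure (EuclideanSpace ℝ (Fin D) × EuclideanSpace ℝ (Fin D))} (h : γ ∈ plans μ ν) :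
    IsProbabilityMeasure γ := by
  have hm := μ.2.1
  rw [← h.1] at hm
  exact Measure.isProbabilityMeasure_of_map Prod.fst

/-- Gluing: a measure `γ` on `X` and a measure `σ` on `Y × Z` whose first marginal is the image of
`γ` under `f` are both images of one measure on `X × Z`. -/
theorem exists_gluing {X Y Z : Type*} [MeasurableSpace X] [MeasurableSpace Y]
    [MeasurableSpace Z] [StandardBorelSpace Z] [Nonempty Z] {γ : Measure X} [IsFiniteMeasure γ]
    {σ : Measure (Y × Z)} [IsFiniteMeasure σ] {f : X → Y} (hf : Measurable f)
    (h : σ.map Prod.fst = γ.map f) :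
    ∃ G : Measure (X × Z), G.map Prod.fst = γ ∧ G.map (fun p => (f p.1, p.2)) = σ := by
  -- Draw `x` from `γ`, then `z` from the conditional law of `σ` given `f x`.
  refine ⟨γ ⊗ₘ (σ.condKernel.comap f hf), Measure.fst_compProd _ _, ?_⟩
  have hσ : σ.map Prod.fst ⊗ₘ σ.condKernel = σ := σ.disintegrate σ.condKernel
  ext s hs
  have hmeas : Measurable fun p : X × Z => (f p.1, p.2) := by fun_prop
  rw [Measure.map_apply hmeas hs, Measure.compProd_apply (hmeas hs)]
  conv_rhs => rw [← hσ, h]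
  rw [Measure.compProd_apply hs, lintegral_map (ProbabilityTheory.Kernel.measurable_kernel_prodMk_left hs) hf]
  rfl

/-- With `a = x - z` and `b = y - z`, the cross terms `±2t(1-t)⟪a, b⟫` on the right cancel. -/
theorem convexComb_sub_sq_add {E : Type*} [NormedAddCommGroup E] [InnerProductSpace ℝ E]
    (x y z : E) (t : ℝ) :
    (1 - t) * ‖x - z‖ ^ 2 + t * ‖y - z‖ ^ 2
      = ‖((1 - t) • x + t • y) - z‖ ^ 2 + t * (1 - t) * ‖x - y‖ ^ 2 := by
  have h1 : ((1 - t) • x + t • y) - z = (1 - t) • (x - z) + t • (y - z) := by module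
  have h2 : x - y = (x - z) - (y - z) := by abel
  rw [h1, h2]
  generalize x - z = a
  generalize y - z = b
  rw [norm_add_sq_real, norm_sub_sq_real, norm_smul, norm_smul, mul_pow, mul_pow,
    inner_smul_left, inner_smul_right]
  simp only [Real.norm_eq_abs, sq_abs, conj_trivial]
  ring

theorem enorm_sq_eq_ofReal {E : Type*} [NormedAddCommGroup E] (x : E) :
    ‖x‖ₑ ^ 2 = ENNReal.ofReal (‖x‖ ^ 2) := by
  rw [ENNReal.ofReal_pow (norm_nonneg x), ofReal_norm]

theorem convexComb_sub_enorm_sq_add {E : Type*} [NormedAddCommGroup E] [InnerProductSpace ℝ E]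
    (x y z : E) {t : ℝ} (ht : t ∈ Icc (0 : ℝ) 1) :
    ENNReal.ofReal (1 - t) * ‖x - z‖ₑ ^ 2 + ENNReal.ofReal t * ‖y - z‖ₑ ^ 2
      = ‖((1 - t) • x + t • y) - z‖ₑ ^ 2 + ENNReal.ofReal (t * (1 - t)) * ‖x - y‖ₑ ^ 2 := by
  have h0 := ht.1
  have h1 : 0 ≤ 1 - t := sub_nonneg.2 ht.2
  simp only [enorm_sq_eq_ofReal]
  rw [← ENNReal.ofReal_mul h1, ← ENNReal.ofReal_mul h0, ← ENNReal.ofReal_mul (by positivity),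
    ← ENNReal.ofReal_add (by positivity) (by positivity),
    ← ENNReal.ofReal_add (by positivity) (by positivity), convexComb_sub_sq_add]

/-- Any plan `γ` will do here; optimality only turns `cost γ` into `W2 μ₀ μ₁ ^ 2` later. -/
theorem iInf_cost_interp {D : ℕ} {μ₀ μ₁ : P2 D} (ν : P2 D)
    {γ : Measure (EuclideanSpace ℝ (Fin D) × EuclideanSpace ℝ (Fin D))}
    (hγ : γ ∈ plans μ₀ μ₁) {t : ℝ} (ht : t ∈ Icc (0 : ℝ) 1) :
    ENNReal.ofReal (1 - t) * (⨅ σ ∈ plans μ₀ ν, cost σ)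
        + ENNReal.ofReal t * (⨅ σ ∈ plans μ₁ ν, cost σ)
      ≤ (⨅ σ ∈ plans (interp γ hγ t) ν, cost σ) + ENNReal.ofReal (t * (1 - t)) * cost γ := by
  have := isProbabilityMeasure_of_mem_plans hγ
  simp only [ENNReal.iInf_add]
  refine le_iInf₂ fun σ hσ => ?_
  have := isProbabilityMeasure_of_mem_plans hσ
  let m : EuclideanSpace ℝ (Fin D) × EuclideanSpace ℝ (Fin D) → EuclideanSpace ℝ (Fin D) :=
    fun p => (1 - t) • p.1 + t • p.2
  have hm : Measurable m := by fun_prop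
  -- `G` is a law of `((x, y), z)` with `(x, y)` distributed as `γ` and `(m (x, y), z)` as `σ`.
  obtain ⟨G, hG1, hG2⟩ := exists_gluing (γ := γ) (σ := σ) hm hσ.1
  have hGsnd : G.map Prod.snd = ν.1 := by
    rw [← hσ.2, ← hG2, Measure.map_map (by fun_prop) (by fun_prop)]
    rfl
  have h0 : G.map (fun p => (p.1.1, p.2)) ∈ plans μ₀ ν := by
    constructor
    · rw [Measure.map_map (by fun_prop) (by fun_prop), ← hγ.1, ← hG1,
        Measure.map_map (by fun_prop) (by fun_prop)]
      rfl
    · rw [Measure.map_map (by fun_prop) (by fun_prop), ← hGsnd]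
      rfl
  have h1 : G.map (fun p => (p.1.2, p.2)) ∈ plans μ₁ ν := by
    constructor
    · rw [Measure.map_map (by fun_prop) (by fun_prop), ← hγ.2, ← hG1,
        Measure.map_map (by fun_prop) (by fun_prop)]
      rfl
    · rw [Measure.map_map (by fun_prop) (by fun_prop), ← hGsnd]
      rfl
  have c0 := iInf₂_le (f := fun σ (_ : σ ∈ plans μ₀ ν) => cost σ) _ h0
  have c1 := iInf₂_le (f := fun σ (_ : σ ∈ plans μ₁ ν) => cost σ) _ h1
  -- The only loss is that the laws of `(x, z)` and `(y, z)` need not be optimal; the rest is an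
  -- equality of integrals against `G`.
  refine (add_le_add (mul_le_mul_right c0 _) (mul_le_mul_right c1 _)).trans (le_of_eq ?_)
  conv_rhs => rw [← hG2, ← hG1]
  unfold cost
  rw [lintegral_map (by fun_prop) (by fun_prop), lintegral_map (by fun_prop) (by fun_prop),
    lintegral_map (by fun_prop) (by fun_prop), lintegral_map (by fun_prop) (by fun_prop),
    ← lintegral_const_mul _ (by fun_prop), ← lintegral_const_mul _ (by fun_prop),
    ← lintegral_const_mul _ (by fun_prop), ← lintegral_add_left (by fun_prop),
    ← lintegral_add_left (by fun_prop)]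
  exact lintegral_congr fun p => convexComb_sub_enorm_sq_add p.1.1 p.1.2 p.2 ht

theorem W2_sq {D : ℕ} (μ ν : P2 D) : W2 μ ν ^ 2 = (⨅ γ ∈ plans μ ν, cost γ).toReal :=
  Real.sq_sqrt ENNReal.toReal_nonneg

theorem ofReal_W2_sq {D : ℕ} (μ ν : P2 D) :
    ENNReal.ofReal (W2 μ ν ^ 2) = ⨅ γ ∈ plans μ ν, cost γ := by
  rw [W2_sq, ENNReal.ofReal_toReal (iInf_cost_lt_top μ ν).ne]

theorem cost_eq_of_mem_optimalPlans {D : ℕ} {μ ν : P2 D}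
    {γ : Measure (EuclideanSpace ℝ (Fin D) × EuclideanSpace ℝ (Fin D))}
    (hγ : γ ∈ optimalPlans μ ν) : cost γ = ENNReal.ofReal (W2 μ ν ^ 2) := by
  rw [ofReal_W2_sq]
  exact le_antisymm (le_iInf₂ hγ.2) (iInf₂_le _ hγ.1)

/-- The squared Wasserstein distance from `ν` is `2`-concave along geodesics: the Wasserstein space
is positively curved in the sense of Alexandrov. -/
theorem W2_sq_interp {D : ℕ} {μ₀ μ₁ : P2 D} (ν : P2 D)
    {γ : Measure (EuclideanSpace ℝ (Fin D) × EuclideanSpace ℝ (Fin D))}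
    (hγ : γ ∈ optimalPlans μ₀ μ₁) {t : ℝ} (ht : t ∈ Icc (0 : ℝ) 1) :
    (1 - t) * W2 μ₀ ν ^ 2 + t * W2 μ₁ ν ^ 2
      ≤ W2 (interp γ hγ.1 t) ν ^ 2 + t * (1 - t) * W2 μ₀ μ₁ ^ 2 := by
  have h := (iInf_cost_interp ν hγ.1 ht).trans
    (add_le_add le_rfl (mul_le_mul_right (cost_eq_of_mem_optimalPlans hγ).le _))
  have h0 := ht.1
  have h1 : 0 ≤ 1 - t := sub_nonneg.2 ht.2
  rw [← ofReal_W2_sq, ← ofReal_W2_sq, ← ofReal_W2_sq,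
    ← ENNReal.ofReal_mul h1, ← ENNReal.ofReal_mul h0, ← ENNReal.ofReal_mul (by positivity),
    ← ENNReal.ofReal_add (by positivity) (by positivity),
    ← ENNReal.ofReal_add (by positivity) (by positivity),
    ENNReal.ofReal_le_ofReal_iff (by positivity)] at h
  exact h

theorem moreauYosida_lt_top {D : ℕ} {H : P2 D → EReal} (hH : IsProper H) (τ : ℝ) (μ : P2 D) :
    moreauYosida H τ μ < ⊤ := by
  obtain ⟨ν, hν⟩ := hH.2
  exact (iInf_le _ ν).trans_lt (EReal.add_lt_top (EReal.coe_ne_top _) hν)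

theorem convexAlongGeodesics_neg_moreauYosida {D : ℕ} {H : P2 D → EReal} (hH : ∀ ν, H ν ≠ ⊥)
    {τ : ℝ} (hτ : 0 < τ) :
    ConvexAlongGeodesics (fun μ => -moreauYosida H τ μ) (-(1 / τ)) := by
  intro μ₀ μ₁ γ hγ t ht
  have h0 := ht.1
  have h1 : 0 ≤ 1 - t := sub_nonneg.2 ht.2
  rw [EReal.neg_le]
  refine le_iInf fun ν => ?_
  induction hν : H ν with
  | bot => exact absurd hν (hH ν)
  | top => exact le_top.trans_eq (EReal.coe_add_top _).symm
  | coe h =>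
    -- The same `ν` competes in the infima at `μ₀` and `μ₁`. The real lower bound for `-H_τ` also
    -- covers `H_τ = -∞` and reduces the claim to real arithmetic.
    have key (μ : P2 D) :
        ((-(1 / (2 * τ) * W2 μ ν ^ 2 + h) : ℝ) : EReal) ≤ -moreauYosida H τ μ := by
      rw [EReal.coe_neg, EReal.neg_le_neg_iff, EReal.coe_add, ← hν]
      exact iInf_le _ ν
    rw [EReal.neg_le, ← EReal.coe_add, ← EReal.coe_neg]
    refine le_trans ?_ (EReal.sub_le_sub
      (add_le_add (mul_le_mul_of_nonneg_left (key μ₀) (EReal.coe_nonneg.2 h1))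
        (mul_le_mul_of_nonneg_left (key μ₁) (EReal.coe_nonneg.2 h0))) le_rfl)
    rw [← EReal.coe_mul, ← EReal.coe_mul, ← EReal.coe_add, ← EReal.coe_sub, EReal.coe_le_coe_iff]
    have hW := mul_le_mul_of_nonneg_left (W2_sq_interp ν hγ ht)
      (by positivity : 0 ≤ 1 / (2 * τ))
    have e : -(1 / τ) / 2 = -(1 / (2 * τ)) := by field_simp
    rw [e]
    linarith

theorem isLambdaConcave_moreauYosida {D : ℕ} {H : P2 D → EReal} (hH : IsProper H)
    {τ : ℝ} (hτ : 0 < τ) (h : ∃ μ, ⊥ < moreauYosida H τ μ) :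
    IsLambdaConcave (moreauYosida H τ) (1 / τ) := by
  refine ⟨⟨fun μ hμ => ?_, ?_⟩, convexAlongGeodesics_neg_moreauYosida hH.1 hτ⟩
  · exact (moreauYosida_lt_top hH τ μ).ne (EReal.neg_eq_bot_iff.1 hμ)
  · obtain ⟨μ, hμ⟩ := h
    exact ⟨μ, fun h' => hμ.ne' (EReal.neg_eq_top_iff.1 h')⟩

/-- A larger `τ` penalizes distance less. Hence finiteness at the coercivity parameter passes to all
smaller ones. -/
theorem moreauYosida_antitone {D : ℕ} (H : P2 D → EReal) {τ τ' : ℝ} (hτ : 0 < τ) (h : τ ≤ τ')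
    (μ : P2 D) : moreauYosida H τ' μ ≤ moreauYosida H τ μ := by
  refine iInf_mono fun ν => add_le_add_left (EReal.coe_le_coe_iff.2 ?_) _
  gcongr

end Wass

theorem mainTheorem6 (D : ℕ) (H : Wass.P2 D → EReal)
    (hproper : Wass.IsProper H) (hcoercive : Wass.IsCoercive H) :
    (∀ τ : ℝ, 0 < τ →
      (∀ μ : Wass.P2 D, Wass.moreauYosida H τ μ < ⊤) ∧
      Wass.ConvexAlongGeodesics (fun μ => -Wass.moreauYosida H τ μ) (-(1 / τ)) ∧
      ((∃ μ : Wass.P2 D, ⊥ < Wass.moreauYosida H τ μ) →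
        Wass.IsLambdaConcave (Wass.moreauYosida H τ) (1 / τ))) ∧
    (∃ τs : ℝ, 0 < τs ∧ ∀ τ : ℝ, 0 < τ → τ ≤ τs →
      Wass.IsLambdaConcave (Wass.moreauYosida H τ) (1 / τ)) := by
  refine ⟨fun τ hτ => ⟨Wass.moreauYosida_lt_top hproper τ,
    Wass.convexAlongGeodesics_neg_moreauYosida hproper.1 hτ,
    Wass.isLambdaConcave_moreauYosida hproper hτ⟩, ?_⟩
  obtain ⟨τs, hτs, μ, hμ⟩ := hcoercive
  exact ⟨τs, hτs, fun τ hτ hle => Wass.isLambdaConcave_moreauYosida hproper hτ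
    ⟨μ, hμ.trans_le (Wass.moreauYosida_antitone H hτ hle μ)⟩⟩
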